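/- Let $E$ and $V$ be real vector spaces (of arbitrary dimension), let $m\ge 2$ be an integer, and let $\Delta_m\subseteq E$ be an $m$-dimensional simplex, i.e. the convex hull of $m+1$ affinely independent points. Let $f:\Delta_m\to V$ be one-to-one and monotone, where monotone means that it preserves betweenness: for all $a,x,b\in\Delta_m$, if $x$ lies in the segment $[a,b]$, then $f(x)$ lies in the segment $[f(a),f(b)]$. Then $f(\Delta_m)$ is an $m$-dimensional simplex, and $f$ is a partial homography, in the following sense. Let $A$ and $B$ be the affine hulls of $\Delta_m$ and $f(\Delta_m)$, and let $\hat A$, $\hat B$ be their projective completions: $\hat A$ is the projective space of the linear subspace of $E\times\mathbb R$ spanned by $\{(x,1):x\in A\}$, a point $x\in A$ being identified with $[x:1]\in\hat A$, and similarly $\hat B$ in $V\times\mathbb R$. Then there is a homography $g:\hat A\to\hat B$ that extends $f$, i.e. $g([x:1])=[f(x):1]$ for all $x\in\Delta_m$. Here a homography is a bijection $g:\hat A\to\hat B$ that maps projective lines onto projective lines and that is a projective transformation, i.e. there are an affine map $T:E\to V$ and an affine functional $d:E\to\mathbb R$ (so $d(x)=\alpha+\varphi(x)$ with $\alpha\in\mathbb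 R$ and $\varphi$ linear) with $g([x:1])=[T(x):d(x)]$ for all $x\in A$; thus $g$ is $x\mapsto \frac{1}{d(x)}T(x)$ at the points $x\in A$ with $d(x)\neq 0$. In particular, $d(x)\ne 0$ and $f(x)=\frac{1}{d(x)}T(x)$ for all $x\in\Delta_m$. -/

import Mathlib

open scoped LinearAlgebra.Projectivization

/-- A mapping `f : S → V`, defined on a subset `S` of a real vector space, is monotone if it preserves
the euclidean betweenness: whenever `x` lies on the segment joining `a` and `b` (all three in `S`),
`f x` lies on the segment joining `f a` and `f b`. -/
def IsMonotoneMap {E V : Type*} [AddCommGroup E] [Module ℝ E] [AddCommGroup V] [Module ℝ V]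
    {S : Set E} (f : S → V) : Prop :=
  ∀ a x b : S, Wbtw ℝ (a : E) (x : E) (b : E) → Wbtw ℝ (f a) (f x) (f b)

/-- `S` is an `m`-dimensional simplex: the convex hull of `m + 1` affinely independent points. -/
def IsSimplex {E : Type*} [AddCommGroup E] [Module ℝ E] (m : ℕ) (S : Set E) : Prop :=
  ∃ p : Fin (m + 1) → E, AffineIndependent ℝ p ∧ S = convexHull ℝ (Set.range p)

/-- The linear subspace of `E × ℝ` spanned by the vectors `(x, 1)` with `x ∈ A`. -/
def homogenization {E : Type*} [AddCommGroup E] [Module ℝ E] (A : AffineSubspace ℝ E) :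
    Submodule ℝ (E × ℝ) :=
  Submodule.span ℝ ((fun x : E => (x, (1 : ℝ))) '' (A : Set E))

/-- The projective completion of the affine space `A`: the points of `A`, together with one point at
infinity for each direction of `A`. -/
abbrev ProjectiveCompletion {E : Type*} [AddCommGroup E] [Module ℝ E] (A : AffineSubspace ℝ E) :
    Type _ :=
  ℙ ℝ (homogenization A)

/-- A point `x` of `A`, as the point `[x : 1]` of the projective completion of `A`. -/
noncomputable def toProjective {E : Type*} [AddCommGroup E] [Module ℝ E] (A : AffineSubspace ℝ E)
    (x : E) (hx : x ∈ A) : ProjectiveCompletion A :=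
  Projectivization.mk ℝ
    (⟨(x, 1), Submodule.subset_span ⟨x, hx, rfl⟩⟩ : homogenization A)
    (fun h => one_ne_zero (congrArg (fun w : homogenization A => (w : E × ℝ).2) h))

/-- A set of points of a projective space is a line if it consists of the points that lie in some
two-dimensional linear subspace. -/
def IsProjectiveLine {U : Type*} [AddCommGroup U] [Module ℝ U] (l : Set (ℙ ℝ U)) : Prop :=
  ∃ M : Submodule ℝ U, Module.finrank ℝ M = 2 ∧ l = {q : ℙ ℝ U | q.submodule ≤ M}

/-- A map between the projective completions of `A` and `B` is a projective transformation if
there are an affine `T` and an affine functional `d` (that is, `d x = α + φ x` with `φ` linear)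
such that `x ∈ A` is sent to the point `[T x : d x]`. So `x` is sent to the affine point
`(1 / d x) • T x` if `d x ≠ 0`, and to the point at infinity in direction `T x` if `d x = 0`. -/
def IsProjectiveTransformation {E V : Type*} [AddCommGroup E] [Module ℝ E]
    [AddCommGroup V] [Module ℝ V] {A : AffineSubspace ℝ E} {B : AffineSubspace ℝ V}
    (g : ProjectiveCompletion A → ProjectiveCompletion B) : Prop :=
  ∃ (T : E →ᵃ[ℝ] V) (d : E →ᵃ[ℝ] ℝ), ∀ (x : E) (hx : x ∈ A),
    (g (toProjective A x hx)).submodule.map (homogenization B).subtype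
      = Submodule.span ℝ {(T x, d x)}

/-- A homography is an isomorphism of real projective spaces: a bijective projective transformation
mapping lines onto lines. -/
def IsHomography {E V : Type*} [AddCommGroup E] [Module ℝ E]
    [AddCommGroup V] [Module ℝ V] {A : AffineSubspace ℝ E} {B : AffineSubspace ℝ V}
    (g : ProjectiveCompletion A → ProjectiveCompletion B) : Prop :=
  Function.Bijective g ∧ (∀ l, IsProjectiveLine l → IsProjectiveLine (g '' l)) ∧
    IsProjectiveTransformation g

/-- `f : S → V` is a partial homography if some homography, from the projective completion of the
affine hull of `S` onto the projective completion of the affine hull of `f(S)`, extends `f`. -/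
def IsPartialHomography {E V : Type*} [AddCommGroup E] [Module ℝ E] [AddCommGroup V] [Module ℝ V]
    {S : Set E} (f : S → V) : Prop :=
  ∃ g : ProjectiveCompletion (affineSpan ℝ S) →
      ProjectiveCompletion (affineSpan ℝ (Set.range f)),
    IsHomography g ∧
    ∀ x : S, g (toProjective _ (x : E) (subset_affineSpan ℝ S x.2)) =
      toProjective _ (f x) (subset_affineSpan ℝ (Set.range f) (Set.mem_range_self x))

/-!
In homogeneous barycentric coordinates `x` on the simplex, the claim is that `f` multiplies `x i` by
a positive weight `w i`; then `(p i, 1) ↦ w i • (f (p i), 1)` is the linear map that induces the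
homography.

*The vertices `p i` have affinely independent images.* For a triangle, suppose that the images are
collinear, so that `f` is real-valued and injective. On each edge, `f` is monotone and has a
continuity point `o`. As `f` is injective and continuous at `o` along the edge, the side of `f o` on
which `f x` lies does not change while `x` moves off the edge. So for any two of the three chosen
points `o`, the center of the triangle and the other point lie on the same side of the first one.
But two of the three values `f o` lie on the same side of the value at the center, and then each
would be on the same side of the other. In higher dimensions, a Radon partition of the images of the
vertices would give, by the case of the facets, a point common to two disjoint faces.

*Weights.* For a point with `j`-th coordinate positive, the ratio of the coordinates `k` and `j` of
its image depends only on the ratio of its own coordinates `k` and `j`, through a function `φ k`. As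
betweenness is preserved, `φ k` maps the midpoint of `s` and `t` to an affine combination of `φ k s`
and `φ k t` whose weights are the same for all `k`. Since there are at least two indices `k`, whose
arguments can be chosen independently, the weights are constant, hence `1 / 2`. A nonnegative
function that preserves midpoints and vanishes at `0` is linear.
-/

section MonotoneMap

variable {E V : Type*} [AddCommGroup E] [Module ℝ E] [AddCommGroup V] [Module ℝ V]

namespace IsMonotoneMap

theorem mono {S T : Set E} {f : E → V} (hf : IsMonotoneMap (T.domRestrict f)) (hST : S ⊆ T) :
    IsMonotoneMap (S.domRestrict f) :=
  fun a x b => hf ⟨a, hST a.2⟩ ⟨x, hST x.2⟩ ⟨b, hST b.2⟩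

theorem mapsTo_convexHull {S : Set E} {f : E → V}
    (hf : IsMonotoneMap ((convexHull ℝ S).domRestrict f)) :
    Set.MapsTo f (convexHull ℝ S) (convexHull ℝ (f '' S)) := by
  suffices h : convexHull ℝ S ⊆ convexHull ℝ S ∩ f ⁻¹' convexHull ℝ (f '' S) from
    fun x hx => (h hx).2
  refine convexHull_min (fun x hx => ⟨subset_convexHull ℝ S hx,
    subset_convexHull ℝ _ (Set.mem_image_of_mem f hx)⟩) ?_
  refine convex_iff_segment_subset.2 fun a ha b hb x hx => ?_
  have hxS := (convex_convexHull ℝ S).segment_subset ha.1 hb.1 hx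
  exact ⟨hxS, (convex_convexHull ℝ _).segment_subset ha.2 hb.2 <| mem_segment_iff_wbtw.2 <|
    hf ⟨a, ha.1⟩ ⟨x, hxS⟩ ⟨b, hb.1⟩ (mem_segment_iff_wbtw.1 hx)⟩

theorem exists_continuousAt {h : ℝ → ℝ} (hh : IsMonotoneMap ((Set.Ioi 0).domRestrict h)) :
    ∃ τ > 0, ContinuousAt h τ := by
  have hquasi : QuasilinearOn ℝ (Set.Ioi 0) h := by
    refine quasilinearOn_iff_mem_uIcc.2 ⟨convex_Ioi 0, fun a ha b hb s t hs ht hst => ?_⟩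
    rw [← segment_eq_uIcc, mem_segment_iff_wbtw]
    exact hh ⟨a, ha⟩ ⟨_, convex_Ioi 0 ha hb hs ht hst⟩ ⟨b, hb⟩
      (mem_segment_iff_wbtw.1 ⟨s, t, hs, ht, hst, rfl⟩)
  have hcount : {x ∈ Set.Ioi (0 : ℝ) | ¬ContinuousWithinAt h (Set.Ioi 0) x}.Countable :=
    hquasi.monotoneOn_or_antitoneOn.elim (·.countable_not_continuousWithinAt)
      (·.countable_not_continuousWithinAt)
  obtain ⟨τ, hcont, hτ⟩ :=
    (hcount.dense_compl ℝ).exists_mem_open isOpen_Ioi ⟨1, Set.mem_Ioi.2 one_pos⟩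
  exact ⟨τ, hτ, (not_not.1 fun h => hcont ⟨hτ, h⟩).continuousAt (Ioi_mem_nhds hτ)⟩

end IsMonotoneMap

end MonotoneMap

section HomogeneousMonotone

variable {ι E V : Type*} [AddCommGroup E] [Module ℝ E] [AddCommGroup V] [Module ℝ V]

/-- A betweenness preserving map in homogeneous barycentric coordinates: `G` is defined on the cone
of nonnegative nonzero coordinate vectors (`0 < x` in the pointwise order), depends on `x` only up
to a positive factor, and preserves betweenness. As `x` and `y` are rescaled, `x + y` runs over the
open segment between the points they represent, so that sums suffice to express betweenness. -/
structure HomogeneousMonotone (G : (ι → ℝ) → V) : Prop where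
  map_smul : ∀ ⦃c : ℝ⦄, 0 < c → ∀ ⦃x : ι → ℝ⦄, 0 < x → G (c • x) = G x
  wbtw_add : ∀ ⦃x y : ι → ℝ⦄, 0 < x → 0 < y → Wbtw ℝ (G x) (G (x + y)) (G y)

namespace HomogeneousMonotone

theorem affineMap_comp {W : Type*} [AddCommGroup W] [Module ℝ W] {G : (ι → ℝ) → V}
    (hG : HomogeneousMonotone G) (A : V →ᵃ[ℝ] W) : HomogeneousMonotone (A ∘ G) where
  map_smul _ hc _ hx := congrArg A (hG.map_smul hc hx)
  wbtw_add _ _ hx hy := (hG.wbtw_add hx hy).map A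

theorem wbtw {G : (ι → ℝ) → V} (hG : HomogeneousMonotone G) {x y z : ι → ℝ} (hx : 0 < x)
    (hz : 0 < z) (h : Wbtw ℝ x y z) : Wbtw ℝ (G x) (G y) (G z) := by
  obtain ⟨a, b, ha, hb, hab, rfl⟩ := mem_segment_iff_wbtw.2 h
  rcases ha.eq_or_lt with rfl | ha
  · simp [(zero_add b).symm.trans hab]
  rcases hb.eq_or_lt with rfl | hb
  · simp [(add_zero a).symm.trans hab]
  simpa only [hG.map_smul ha hx, hG.map_smul hb hz] using
    hG.wbtw_add (smul_pos ha hx) (smul_pos hb hz)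

end HomogeneousMonotone

theorem IsMonotoneMap.homogeneousMonotone [Fintype ι] {p : ι → E} {f : E → V}
    (hf : IsMonotoneMap ((convexHull ℝ (Set.range p)).domRestrict f)) :
    HomogeneousMonotone fun x => f (Finset.univ.centerMass x p) where
  map_smul _ hc _ _ := congrArg f (Finset.centerMass_smul_left _ _ hc.ne')
  wbtw_add x y hx hy := by
    have hsum {x : ι → ℝ} (hx : 0 < x) : 0 < ∑ i, x i := Fintype.sum_pos hx
    have hmem {x : ι → ℝ} (hx : 0 < x) :
        Finset.univ.centerMass x p ∈ convexHull ℝ (Set.range p) :=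
      Finset.centerMass_mem_convexHull _ (fun i _ => hx.le i) (hsum hx) fun i _ => ⟨i, rfl⟩
    refine hf ⟨_, hmem hx⟩ ⟨_, hmem (add_pos hx hy)⟩ ⟨_, hmem hy⟩ (mem_segment_iff_wbtw.1 ?_)
    have hx' := hsum hx
    have hy' := hsum hy
    refine ⟨(∑ i, x i) / (∑ i, x i + ∑ i, y i), (∑ i, y i) / (∑ i, x i + ∑ i, y i),
      by positivity, by positivity, by field_simp, ?_⟩
    simp only [Finset.centerMass, Pi.add_apply, Finset.sum_add_distrib, add_smul, smul_smul,
      smul_add]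
    congr 2 <;> field_simp

end HomogeneousMonotone

section EdgePoint

variable {ι : Type*} [DecidableEq ι]

/-- The affine parametrization `t ↦ e_a + t e_b` of the edge `ab` in homogeneous barycentric
coordinates: every point of that edge other than the vertex `b` is represented with `0 ≤ t`. -/
def edgePoint (a b : ι) : ℝ →ᵃ[ℝ] (ι → ℝ) :=
  AffineMap.const ℝ ℝ (Pi.single a 1 : ι → ℝ) +
    (LinearMap.single ℝ (fun _ : ι => ℝ) b).toAffineMap

theorem edgePoint_apply (a b : ι) (t : ℝ) : edgePoint a b t = Pi.single a 1 + Pi.single b t :=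
  rfl

theorem edgePoint_apply_left {a b : ι} (hab : a ≠ b) (t : ℝ) : edgePoint a b t a = 1 := by
  simp [edgePoint_apply, hab]

theorem edgePoint_apply_right {a b : ι} (hab : a ≠ b) (t : ℝ) : edgePoint a b t b = t := by
  simp [edgePoint_apply, hab.symm]

theorem edgePoint_apply_of_ne {a b i : ι} (hia : i ≠ a) (hib : i ≠ b) (t : ℝ) :
    edgePoint a b t i = 0 := by
  simp [edgePoint_apply, hia, hib]

theorem edgePoint_pos (a b : ι) {t : ℝ} (ht : 0 ≤ t) : 0 < edgePoint a b t :=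
  add_pos_of_pos_of_nonneg (Pi.single_pos.2 one_pos) (Pi.single_nonneg.2 ht)

end EdgePoint

section Triangle

namespace HomogeneousMonotone

variable {ι : Type*} {G : (ι → ℝ) → ℝ} {c : ι} {o x y : ι → ℝ}

theorem eventually_apply_lt [Finite ι] (hG : HomogeneousMonotone G) (ho : 0 < o) (hoc : o c = 0)
    (hoi : ∀ i ≠ c, 0 < o i) (hcont : ContinuousWithinAt G {x | 0 < x ∧ x c = 0} o)
    (hne : ∀ x, 0 < x → 0 < x c → G x ≠ G o) (hx : 0 < x) (hxc : 0 < x c) (hlt : G o < G x) :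
    ∀ᶠ y in nhdsWithin x {y | 0 < y ∧ 0 < y c}, G o < G y := by
  have hox : G o < G (o + x) := by
    have hbetween := (wbtw_iff_of_le hlt.le).1 (hG.wbtw_add ho hx)
    exact hbetween.1.lt_of_ne (hne _ (add_pos ho hx) (by simpa [hoc])).symm
  -- Moving `x` to a nearby `y` is compensated by moving `o` to a nearby point `o' y` of its face.
  let o' : (ι → ℝ) → ι → ℝ := fun y => o + x - (x c / y c) • y
  have ho' : Filter.Tendsto o' (nhdsWithin x {y | 0 < y ∧ 0 < y c}) (nhds o) := by
    have : ContinuousAt o' x := continuousAt_const.sub <|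
      (continuousAt_const.div (continuous_apply c).continuousAt hxc.ne').smul continuousAt_id
    simpa [ContinuousAt, o', div_self hxc.ne'] using this.mono_left nhdsWithin_le_nhds
  have hface : ∀ᶠ y in nhdsWithin x {y | 0 < y ∧ 0 < y c}, 0 < o' y ∧ o' y c = 0 := by
    have hpos : ∀ᶠ y in nhdsWithin x {y | 0 < y ∧ 0 < y c}, ∀ i ≠ c, 0 < o' y i := by
      simp only [Filter.eventually_all]
      exact fun i hi => (ho'.apply_nhds i).eventually_const_lt (hoi i hi)
    obtain ⟨i, hi⟩ := (Pi.lt_def.1 ho).2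
    have hic : i ≠ c := fun h => by simp [h, hoc] at hi
    filter_upwards [hpos, self_mem_nhdsWithin] with y hpos hy
    have hoc' : o' y c = 0 := by simp [o', hoc, hy.2.ne']
    refine ⟨Pi.lt_def.2 ⟨fun j => ?_, i, hpos i hic⟩, hoc'⟩
    rcases eq_or_ne j c with rfl | hj
    exacts [hoc'.ge, (hpos j hj).le]
  have hlt' := (hcont.tendsto.comp (tendsto_nhdsWithin_iff.2 ⟨ho', hface⟩)).eventually_lt_const hox
  filter_upwards [hlt', hface, self_mem_nhdsWithin] with y hlt' hface hy
  have hr : 0 < x c / y c := div_pos hxc hy.2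
  have hbetween := hG.wbtw_add hface.1 (smul_pos hr hy.1)
  rw [hG.map_smul hr hy.1, show o' y + (x c / y c) • y = o + x from sub_add_cancel _ _,
    ← mem_segment_iff_wbtw] at hbetween
  by_contra! hle
  exact ((convex_Iio _).segment_subset hlt' (hle.trans_lt hox) hbetween).false

theorem apply_lt_iff_apply_lt [Finite ι] (hG : HomogeneousMonotone G) (ho : 0 < o) (hoc : o c = 0)
    (hoi : ∀ i ≠ c, 0 < o i) (hcont : ContinuousWithinAt G {x | 0 < x ∧ x c = 0} o)
    (hne : ∀ x, 0 < x → 0 < x c → G x ≠ G o) (hx : 0 < x) (hxc : 0 < x c) (hy : 0 < y)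
    (hyc : 0 < y c) : G o < G x ↔ G o < G y := by
  have hneg : HomogeneousMonotone (-G) := hG.affineMap_comp (-LinearMap.id : ℝ →ₗ[ℝ] ℝ).toAffineMap
  have hconvex : Convex ℝ {x : ι → ℝ | 0 < x ∧ 0 < x c} :=
    (convex_Ioi 0).inter ((convex_Ioi 0).linear_preimage (LinearMap.proj c : (ι → ℝ) →ₗ[ℝ] ℝ))
  refine hconvex.isPreconnected.induction₂ (fun x y => G o < G x ↔ G o < G y) (fun x hx => ?_)
    (fun _ _ _ _ _ _ => Iff.trans) (fun _ _ _ _ => Iff.symm) ⟨hx, hxc⟩ ⟨hy, hyc⟩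
  rcases (hne x hx.1 hx.2).lt_or_gt with hlt | hlt
  · filter_upwards [hneg.eventually_apply_lt ho hoc hoi hcont.neg
      (fun x hx hxc => neg_injective.ne (hne x hx hxc)) hx.1 hx.2 (neg_lt_neg hlt)] with y hy
    exact iff_of_false hlt.not_gt (neg_lt_neg_iff.1 hy).not_gt
  · filter_upwards [hG.eventually_apply_lt ho hoc hoi hcont hne hx.1 hx.2 hlt] with y hy
    exact iff_of_true hlt hy

theorem exists_continuousWithinAt_edge [DecidableEq ι] (hG : HomogeneousMonotone G) {a b : ι}
    (hab : a ≠ b) :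
    ∃ τ > 0, ContinuousWithinAt G {x | 0 < x ∧ ∀ i, i ≠ a → i ≠ b → x i = 0} (edgePoint a b τ) := by
  have hpos {t : ℝ} (ht : 0 < t) := edgePoint_pos a b ht.le
  obtain ⟨τ, hτ, hcont⟩ := IsMonotoneMap.exists_continuousAt (h := G ∘ edgePoint a b)
    fun s t u hstu => hG.wbtw (hpos s.2) (hpos u.2) (hstu.map (edgePoint a b))
  have hratio :
      ContinuousAt (fun x : ι → ℝ => G (edgePoint a b (x b / x a))) (edgePoint a b τ) := by
    refine ContinuousAt.comp (g := G ∘ edgePoint a b) (f := fun x : ι → ℝ => x b / x a) ?_ ?_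
    · simpa only [edgePoint_apply_left hab, edgePoint_apply_right hab, div_one] using hcont
    · exact (continuous_apply b).continuousAt.div (continuous_apply a).continuousAt
        (by simp [edgePoint_apply_left hab])
  refine ⟨τ, hτ, hratio.continuousWithinAt.congr_of_eventuallyEq ?_
    (by simp [edgePoint_apply_left hab, edgePoint_apply_right hab])⟩
  filter_upwards [self_mem_nhdsWithin, nhdsWithin_le_nhds
    ((continuous_apply a).continuousAt.eventually_const_lt
      (by simp [edgePoint_apply_left hab] : 0 < edgePoint a b τ a))] with x hx hxa
  have hx' : x = x a • edgePoint a b (x b / x a) := by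
    ext i
    by_cases hia : i = a
    · simp [hia, edgePoint_apply_left hab]
    by_cases hib : i = b
    · simp [hib, edgePoint_apply_right hab, mul_div_cancel₀ _ hxa.ne']
    · simp [edgePoint_apply_of_ne hia hib, hx.2 i hia hib]
  conv_lhs => rw [hx', hG.map_smul hxa (edgePoint_pos a b (div_nonneg (hx.1.le b) hxa.le))]

theorem exists_continuousWithinAt_face {G : (Fin 3 → ℝ) → ℝ} (hG : HomogeneousMonotone G)
    (c : Fin 3) : ∃ o, 0 < o ∧ o c = 0 ∧ (∀ i ≠ c, 0 < o i) ∧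
      ContinuousWithinAt G {x | 0 < x ∧ x c = 0} o := by
  obtain ⟨a, b, hab, hac, hbc, hcover⟩ :
      ∃ a b : Fin 3, a ≠ b ∧ a ≠ c ∧ b ≠ c ∧ ∀ i, i = a ∨ i = b ∨ i = c := by decide +revert
  obtain ⟨τ, hτ, hcont⟩ := hG.exists_continuousWithinAt_edge hab
  refine ⟨edgePoint a b τ, edgePoint_pos a b hτ.le, edgePoint_apply_of_ne hac.symm hbc.symm τ,
    fun i hi => ?_, hcont.mono fun x hx => ⟨hx.1, fun i hia hib => ?_⟩⟩
  · rcases hcover i with rfl | rfl | rfl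
    exacts [by simp [edgePoint_apply_left hab], by simpa [edgePoint_apply_right hab], absurd rfl hi]
  · obtain rfl : i = c := ((hcover i).resolve_left hia).resolve_left hib
    exact hx.2

theorem exists_apply_eq_of_face {G : (Fin 3 → ℝ) → ℝ} (hG : HomogeneousMonotone G) :
    ∃ x y, 0 < x ∧ 0 < y ∧ G x = G y ∧ ∃ i, y i = 0 ∧ 0 < x i := by
  by_contra! hsep
  choose o ho hoc hoi hcont using hG.exists_continuousWithinAt_face
  have hne (c : Fin 3) (x : Fin 3 → ℝ) (hx : 0 < x) (hxc : 0 < x c) : G x ≠ G (o c) := fun h =>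
    (hsep _ _ hx (ho c) h c (hoc c)).not_gt hxc
  have hside {c d : Fin 3} (hcd : c ≠ d) : G (o c) < G 1 ↔ G (o c) < G (o d) :=
    hG.apply_lt_iff_apply_lt (ho c) (hoc c) (hoi c) (hcont c) (hne c) one_pos one_pos (ho d)
      (hoi d c hcd)
  -- Two of the three values `G (o c)` lie on the same side of `G 1`, hence each lies on the same
  -- side of the other one.
  obtain ⟨c, d, hcd, hsame⟩ :=
    Fintype.exists_ne_map_eq_of_card_lt (fun c => G (o c) < G 1) (by simp)
  rw [hside hcd, hside hcd.symm] at hsame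
  rcases (hne d (o c) (ho c) (hoi c d hcd.symm)).lt_or_gt with hlt | hlt
  · exact hlt.not_gt (hsame.mp hlt)
  · exact hlt.not_gt (hsame.mpr hlt)

end HomogeneousMonotone

end Triangle

section AdditiveFunctions

variable {h k : ℝ → ℝ}

theorem eq_mul_of_add_of_nonneg (hadd : ∀ x y, 0 ≤ x → 0 ≤ y → h (x + y) = h x + h y)
    (hnonneg : ∀ x, 0 ≤ x → 0 ≤ h x) {x : ℝ} (hx : 0 ≤ x) : h x = x * h 1 := by
  have hmul (n : ℕ) {y : ℝ} (hy : 0 ≤ y) : h (n * y) = n * h y := by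
    induction n with
    | zero => simpa using hadd 0 0 le_rfl le_rfl
    | succ n ih => rw [Nat.cast_succ, add_one_mul, add_one_mul, hadd _ _ (by positivity) hy, ih]
  -- `h y - y * h 1` is additive and vanishes at the integers, so it is bounded by its values at
  -- fractional parts.
  have hbound {y : ℝ} (hy : 0 ≤ y) : |h y - y * h 1| ≤ h 1 := by
    set n := ⌊y⌋₊
    have hn : (n : ℝ) ≤ y := Nat.floor_le hy
    have hn' : y < n + 1 := Nat.lt_floor_add_one y
    have hfloor : h y = n * h 1 + h (y - n) := by
      rw [← hmul n zero_le_one, mul_one, ← hadd _ _ n.cast_nonneg (sub_nonneg.2 hn),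
        add_sub_cancel]
    have hfract : h 1 = h (y - n) + h (1 - (y - n)) := by
      rw [← hadd _ _ (by linarith) (by linarith), add_sub_cancel]
    have h₀ := hnonneg (y - n) (by linarith)
    have h₁ := hnonneg (1 - (y - n)) (by linarith)
    rw [abs_le]
    constructor <;> nlinarith [hnonneg 1 zero_le_one]
  by_contra hne
  obtain ⟨n, hn⟩ := exists_nat_gt (h 1 / |h x - x * h 1|)
  rw [div_lt_iff₀ (abs_pos.2 (sub_ne_zero.2 hne))] at hn
  have hle := hbound (mul_nonneg n.cast_nonneg hx)
  rw [hmul n hx, mul_assoc, ← mul_sub, abs_mul, Nat.abs_cast] at hle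
  exact (hn.trans_le hle).false

theorem eq_mul_of_midpoint_of_nonneg
    (hmid : ∀ x y, 0 ≤ x → 0 ≤ y → h ((x + y) / 2) = (h x + h y) / 2) (hzero : h 0 = 0)
    (hnonneg : ∀ x, 0 ≤ x → 0 ≤ h x) {x : ℝ} (hx : 0 ≤ x) : h x = x * h 1 := by
  refine eq_mul_of_add_of_nonneg (fun x y hx hy => ?_) hnonneg hx
  have := hmid (x + y) 0 (add_nonneg hx hy) le_rfl
  rw [add_zero, hmid x y hx hy, hzero] at this
  linarith

theorem map_midpoint_of_common_weights
    (hweight : ∀ x y s t, 0 ≤ x → 0 ≤ y → 0 ≤ s → 0 ≤ t → ∃ α : ℝ,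
      h ((x + y) / 2) = α * h x + (1 - α) * h y ∧ k ((s + t) / 2) = α * k s + (1 - α) * k t)
    (hne : h 0 ≠ h 1) (kne : k 0 ≠ k 1) {x y : ℝ} (hx : 0 ≤ x) (hy : 0 ≤ y) :
    h ((x + y) / 2) = (h x + h y) / 2 := by
  obtain ⟨α, -, hα⟩ := hweight 0 0 0 1 le_rfl le_rfl le_rfl zero_le_one
  have hconst {x y : ℝ} (hx : 0 ≤ x) (hy : 0 ≤ y) : h ((x + y) / 2) = α * h x + (1 - α) * h y := by
    obtain ⟨β, hβ, hβ'⟩ := hweight x y 0 1 hx hy le_rfl zero_le_one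
    have : (α - β) * (k 0 - k 1) = 0 := by linear_combination hβ' - hα
    rwa [sub_eq_zero.1 ((mul_eq_zero.1 this).resolve_right (sub_ne_zero.2 kne))]
  have hhalf : α = 1 / 2 := by
    have h₀₁ := hconst le_rfl zero_le_one
    have h₁₀ := hconst zero_le_one le_rfl
    rw [add_comm (1 : ℝ)] at h₁₀
    have : (2 * α - 1) * (h 0 - h 1) = 0 := by linear_combination h₁₀ - h₀₁
    linarith [(mul_eq_zero.1 this).resolve_right (sub_ne_zero.2 hne)]
  rw [hconst hx hy, hhalf]
  ring

end AdditiveFunctions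

section Rigidity

/-- `G`, which acts on homogeneous barycentric coordinates, maps the relative interior of every face
of the simplex into the relative interior of the same face. -/
structure PreservesSupport {ι : Type*} (G : (ι → ℝ) → ι → ℝ) : Prop where
  apply_eq_zero : ∀ ⦃x : ι → ℝ⦄, 0 < x → ∀ ⦃i⦄, x i = 0 → G x i = 0
  apply_pos : ∀ ⦃x : ι → ℝ⦄, 0 < x → ∀ ⦃i⦄, 0 < x i → 0 < G x i

variable {ι : Type*} {G : (ι → ℝ) → ι → ℝ} {j k l : ι} {x y : ι → ℝ}

/-- The ratio of the coordinates `k` and `j` of `G` on the edge `jk`, as a function of the ratio of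
these coordinates of the argument. -/
noncomputable def edgeRatio [DecidableEq ι] (G : (ι → ℝ) → ι → ℝ) (j k : ι) (t : ℝ) : ℝ :=
  G (edgePoint j k t) k / G (edgePoint j k t) j

namespace HomogeneousMonotone

theorem apply_eq_edgeRatio_mul [DecidableEq ι] (hG : HomogeneousMonotone G)
    (hsupp : PreservesSupport G) (hjk : j ≠ k) (hx : 0 < x) (hxj : 0 < x j) :
    G x k = edgeRatio G j k (x k / x j) * G x j := by
  set e := edgePoint j k (x k / x j)
  have he : 0 < e := edgePoint_pos j k (div_nonneg (hx.le k) hxj.le)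
  have hej : e j = 1 := edgePoint_apply_left hjk _
  have hek : x j * e k = x k := by
    rw [show e k = x k / x j from edgePoint_apply_right hjk _, mul_div_cancel₀ _ hxj.ne']
  have hGej : 0 < G e j := hsupp.apply_pos he (hej ▸ one_pos)
  suffices h : G x k * G e j = G x j * G e k by
    rw [edgeRatio, div_mul_eq_mul_div, eq_div_iff hGej.ne', h, mul_comm]
  have hrest : 0 ≤ x - x j • e := fun i => by
    by_cases hij : i = j
    · simp [hij, hej]
    by_cases hik : i = k
    · simp [hik, hek]
    · simpa [e, edgePoint_apply_of_ne hij hik] using hx.le i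
  -- The coordinates `j` and `k` of `x` come from its projection `x j • e` to the edge `jk` only;
  -- the remaining part of `x` is mapped into the face opposite to this edge.
  rcases hrest.eq_or_lt with hrest | hrest
  · rw [(sub_eq_zero.1 hrest.symm), hG.map_smul hxj he, mul_comm]
  · obtain ⟨a, b, -, -, -, hab⟩ :=
      mem_segment_iff_wbtw.2 (hG.wbtw_add (smul_pos hxj he) hrest)
    have hrj := hsupp.apply_eq_zero hrest (i := j) (by simp [hej])
    have hrk := hsupp.apply_eq_zero hrest (i := k) (by simp [hek])
    rw [add_sub_cancel, hG.map_smul hxj he] at hab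
    simp only [← hab, Pi.add_apply, Pi.smul_apply, hrj, hrk, smul_eq_mul]
    ring

theorem exists_edgeRatio_weight [DecidableEq ι] (hG : HomogeneousMonotone G)
    (hsupp : PreservesSupport G) (hx : 0 < x) (hy : 0 < y) (hxj : x j = 1) (hyj : y j = 1) :
    ∃ α : ℝ, ∀ k ≠ j, edgeRatio G j k ((x k + y k) / 2) =
      α * edgeRatio G j k (x k) + (1 - α) * edgeRatio G j k (y k) := by
  have hratio (k) (hk : k ≠ j) {z : ι → ℝ} (hz : 0 < z) (hzj : 0 < z j) :
      edgeRatio G j k (z k / z j) = G z k / G z j :=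
    (eq_div_iff (hsupp.apply_pos hz hzj).ne').2
      (hG.apply_eq_edgeRatio_mul hsupp hk.symm hz hzj).symm
  have hxyj : (x + y) j = 2 := by simp [hxj, hyj, one_add_one_eq_two]
  have hGx := hsupp.apply_pos hx (hxj ▸ one_pos)
  have hGy := hsupp.apply_pos hy (hyj ▸ one_pos)
  have hGxy := hsupp.apply_pos (add_pos hx hy) (hxyj ▸ two_pos)
  obtain ⟨a, b, -, -, -, hab⟩ := mem_segment_iff_wbtw.2 (hG.wbtw_add hx hy)
  have habi (i) : G (x + y) i = a * G x i + b * G y i := (congrFun hab i).symm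
  refine ⟨a * G x j / G (x + y) j, fun k hk => ?_⟩
  have h₁ := hratio k hk hx (hxj ▸ one_pos)
  have h₂ := hratio k hk hy (hyj ▸ one_pos)
  have h₃ := hratio k hk (add_pos hx hy) (hxyj ▸ two_pos)
  rw [hxj, div_one] at h₁
  rw [hyj, div_one] at h₂
  rw [hxyj, Pi.add_apply] at h₃
  rw [h₁, h₂, h₃, habi k]
  field_simp
  rw [habi j]
  ring

theorem edgeRatio_eq_mul [DecidableEq ι] (hG : HomogeneousMonotone G)
    (hsupp : PreservesSupport G) (hjk : j ≠ k) (hjl : j ≠ l) (hkl : k ≠ l) {t : ℝ} (ht : 0 ≤ t) :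
    edgeRatio G j k t = t * edgeRatio G j k 1 := by
  have hratio_zero {i} (hi : j ≠ i) : edgeRatio G j i 0 = 0 := by
    have he := hsupp.apply_eq_zero (edgePoint_pos j i le_rfl) (edgePoint_apply_right hi 0)
    rw [edgeRatio, he, zero_div]
  have hratio_pos {i} (hi : j ≠ i) {t : ℝ} (ht : 0 < t) : 0 < edgeRatio G j i t := by
    have he := edgePoint_pos j i ht.le
    exact div_pos (hsupp.apply_pos he (by rwa [edgePoint_apply_right hi]))
      (hsupp.apply_pos he (by simp [edgePoint_apply_left hi]))
  have hratio_ne {i} (hi : j ≠ i) : edgeRatio G j i 0 ≠ edgeRatio G j i 1 := by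
    rw [hratio_zero hi]
    exact (hratio_pos hi one_pos).ne
  -- The coordinate `l` can be varied independently of `k` without affecting the weights.
  refine eq_mul_of_midpoint_of_nonneg (fun x y hx hy => map_midpoint_of_common_weights
    (k := edgeRatio G j l) (fun x y s t hx hy hs ht => ?_) (hratio_ne hjk) (hratio_ne hjl) hx hy)
    (hratio_zero hjk) (fun x hx => ?_) ht
  · have hpos' {u v : ℝ} (hu : 0 ≤ u) (hv : 0 ≤ v) : 0 < edgePoint j k u + Pi.single l v :=
      add_pos_of_pos_of_nonneg (edgePoint_pos j k hu) (Pi.single_nonneg.2 hv)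
    obtain ⟨α, hα⟩ := hG.exists_edgeRatio_weight hsupp (j := j) (hpos' hx hs) (hpos' hy ht)
      (by simp [edgePoint_apply_left hjk, hjl]) (by simp [edgePoint_apply_left hjk, hjl])
    refine ⟨α, ?_, ?_⟩
    · simpa [edgePoint_apply_right hjk, hkl] using hα k hjk.symm
    · simpa [edgePoint_apply_of_ne hjl.symm hkl.symm] using hα l hjl.symm
  · rcases hx.eq_or_lt with rfl | hx
    exacts [(hratio_zero hjk).ge, (hratio_pos hjk hx).le]

theorem apply_mul_eq_mul_apply (hG : HomogeneousMonotone G) (hsupp : PreservesSupport G)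
    [Fintype ι] (hι : 3 ≤ Fintype.card ι) (hx : 0 < x) (j k : ι) :
    G x k * (G 1 j * x j) = G 1 k * x k * G x j := by
  classical
  rcases eq_or_ne j k with rfl | hjk
  · ring
  rcases (show 0 ≤ x j from hx.le j).eq_or_lt with hxj | hxj
  · rw [← hxj, hsupp.apply_eq_zero hx hxj.symm]
    simp
  obtain ⟨l, -, hl⟩ := Finset.exists_mem_notMem_of_card_lt_card
    (s := {j, k}) (t := Finset.univ) (Finset.card_le_two.trans_lt hι)
  simp only [Finset.mem_insert, Finset.mem_singleton, not_or] at hl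
  have hone : (0 : ι → ℝ) < 1 := Pi.lt_def.2 ⟨fun _ => zero_le_one, j, one_pos⟩
  have h₁ := hG.apply_eq_edgeRatio_mul hsupp hjk hone one_pos
  rw [Pi.one_apply, Pi.one_apply, div_one] at h₁
  rw [h₁, hG.apply_eq_edgeRatio_mul hsupp hjk hx hxj,
    hG.edgeRatio_eq_mul hsupp hjk (Ne.symm hl.1) (Ne.symm hl.2) (div_nonneg (hx.le k) hxj.le)]
  field_simp

end HomogeneousMonotone

end Rigidity

section AffineInterpolation

variable {K ι E V : Type*} [Field K] [AddCommGroup E] [Module K E] [AddCommGroup V] [Module K V]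

theorem exists_linearMap_apply_eq {u : ι → E} (hu : LinearIndependent K u) (v : ι → V) :
    ∃ L : E →ₗ[K] V, ∀ i, L (u i) = v i := by
  obtain ⟨L, hL⟩ := ((Module.Basis.span hu).constr K v).exists_extend
  refine ⟨L, fun i => ?_⟩
  rw [← (Module.Basis.span hu).constr_basis K v i, ← hL, LinearMap.comp_apply,
    Submodule.subtype_apply, Module.Basis.span_apply]

theorem linearIndependent_prod_one {p : ι → E} (hp : AffineIndependent K p) :
    LinearIndependent K fun i => (p i, (1 : K)) := by
  rw [linearIndependent_iff']
  intro s c hc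
  simp only [Prod.smul_mk, Prod.ext_iff, Prod.fst_sum, Prod.snd_sum, smul_eq_mul, mul_one,
    Prod.fst_zero, Prod.snd_zero] at hc
  exact affineIndependent_iff.1 hp s c hc.2 hc.1

theorem exists_affineMap_apply_eq {p : ι → E} (hp : AffineIndependent K p) (v : ι → V) :
    ∃ A : E →ᵃ[K] V, ∀ i, A (p i) = v i := by
  obtain ⟨L, hL⟩ :=
    exists_linearMap_apply_eq (E := E × K) (linearIndependent_prod_one hp) v
  let lift : E →ᵃ[K] E × K := (AffineMap.id K E).prod (AffineMap.const K E 1)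
  exact ⟨L.toAffineMap.comp lift, hL⟩

theorem affineMap_centerMass [Fintype ι] (A : E →ᵃ[K] V) (p : ι → E) {x : ι → K}
    (hx : ∑ i, x i ≠ 0) :
    A (Finset.univ.centerMass x p) = Finset.univ.centerMass x (A ∘ p) := by
  have hA (y : E) : A y = A.linear y + A 0 := congrFun A.decomp y
  simp only [Finset.centerMass, Function.comp_apply, hA (p _), hA (_ • _), map_smul, map_sum,
    smul_add, Finset.sum_add_distrib, ← Finset.sum_smul, inv_smul_smul₀ hx]

theorem centerMass_pi_single [Fintype ι] [DecidableEq ι] (x : ι → K) :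
    Finset.univ.centerMass x (fun i => Pi.single i (1 : K)) = (∑ i, x i)⁻¹ • x := by
  simp [Finset.centerMass, ← Pi.single_smul, Finset.univ_sum_single]

theorem sum_smul_prod_one [Fintype ι] (p : ι → E) {x : ι → K} (hx : ∑ i, x i ≠ 0) :
    ∑ i, x i • (p i, (1 : K)) = (∑ i, x i) • (Finset.univ.centerMass x p, (1 : K)) := by
  simp [Finset.centerMass, Prod.ext_iff, Prod.fst_sum, Prod.snd_sum, smul_inv_smul₀ hx]

end AffineInterpolation

section BarycentricCoordinates

variable {ι E : Type*} [Fintype ι] [AddCommGroup E] [Module ℝ E]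

theorem mem_convexHull_image_iff_exists_centerMass {p : ι → E} {s : Set ι} {y : E} :
    y ∈ convexHull ℝ (p '' s) ↔
      ∃ x : ι → ℝ, 0 < x ∧ (∀ i ∉ s, x i = 0) ∧ Finset.univ.centerMass x p = y := by
  classical
  constructor
  · intro hy
    have hconvex : Convex ℝ {x | x ∈ stdSimplex ℝ ι ∧ ∀ i ∉ s, x i = 0} := by
      refine (convex_stdSimplex ℝ ι).inter fun x hx y hy a b _ _ _ i hi => ?_
      simp [hx i hi, hy i hi]
    rw [show p '' s = Fintype.linearCombination ℝ p '' ((fun i => Pi.single i 1) '' s) by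
      simp [Set.image_image], ← LinearMap.image_convexHull] at hy
    obtain ⟨x, hx, rfl⟩ := hy
    obtain ⟨⟨hnonneg, hsum⟩, hzero⟩ := convexHull_min
      (t := {x | x ∈ stdSimplex ℝ ι ∧ ∀ i ∉ s, x i = 0})
      (Set.image_subset_iff.2 fun i hi => ⟨single_mem_stdSimplex ℝ i, fun j hj =>
        Pi.single_eq_of_ne (by rintro rfl; exact hj hi) 1⟩) hconvex hx
    refine ⟨x, lt_of_le_of_ne hnonneg ?_, hzero, ?_⟩
    · rintro rfl
      simp at hsum
    · rw [Finset.centerMass_eq_of_sum_1 _ _ hsum, Fintype.linearCombination_apply]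
  · rintro ⟨x, hx, hzero, rfl⟩
    rw [← Finset.centerMass_subset p (Finset.subset_univ {i | i ∈ s}) fun i _ hi =>
      hzero i (by simpa using hi)]
    refine Finset.centerMass_mem_convexHull _ (fun i _ => hx.le i) ?_ fun i hi =>
      ⟨i, by simpa using hi, rfl⟩
    rw [Finset.sum_subset (Finset.subset_univ _) fun i _ hi => hzero i (by simpa using hi)]
    exact Fintype.sum_pos hx

theorem mem_convexHull_range_iff_exists_centerMass {p : ι → E} {y : E} :
    y ∈ convexHull ℝ (Set.range p) ↔ ∃ x : ι → ℝ, 0 < x ∧ Finset.univ.centerMass x p = y := by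
  simp [← Set.image_univ, mem_convexHull_image_iff_exists_centerMass]

theorem eq_zero_of_centerMass_eq {p : ι → E} (hp : AffineIndependent ℝ p) {x y : ι → ℝ}
    (hx : 0 < x) (hy : 0 < y) (h : Finset.univ.centerMass x p = Finset.univ.centerMass y p) {i : ι}
    (hi : y i = 0) : x i = 0 := by
  classical
  obtain ⟨A, hA⟩ := exists_affineMap_apply_eq hp (V := ι → ℝ) fun i => Pi.single i 1
  have hAx {x : ι → ℝ} (hx : 0 < x) : A (Finset.univ.centerMass x p) = (∑ i, x i)⁻¹ • x := by
    rw [affineMap_centerMass A p (Fintype.sum_pos hx).ne', ← centerMass_pi_single x]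
    exact congrArg _ (funext hA)
  have hxy : (∑ i, x i)⁻¹ * x i = (∑ i, y i)⁻¹ * y i :=
    congrFun ((hAx hx).symm.trans ((congrArg A h).trans (hAx hy))) i
  rw [hi, mul_zero] at hxy
  exact (mul_eq_zero.1 hxy).resolve_left (inv_ne_zero (Fintype.sum_pos hx).ne')

end BarycentricCoordinates

section Weights

variable {ι E V : Type*} [AddCommGroup E] [Module ℝ E] [AddCommGroup V] [Module ℝ V]

theorem mul_pos_of_forall_pos {w x : ι → ℝ} (hw : ∀ i, 0 < w i) (hx : 0 < x) : 0 < w * x := by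
  obtain ⟨i, hi⟩ := (Pi.lt_def.1 hx).2
  exact Pi.lt_def.2 ⟨fun i => mul_nonneg (hw i).le (hx.le i), i, mul_pos (hw i) hi⟩

theorem HomogeneousMonotone.preservesSupport {G : (ι → ℝ) → ι → ℝ}
    (hG : HomogeneousMonotone G) (hpos : ∀ x, 0 < x → 0 < G x)
    (hzero : ∀ x, 0 < x → ∀ i, x i = 0 → G x i = 0)
    (hsep : ∀ x y, 0 < x → 0 < y → G x = G y → ∀ i, y i = 0 → x i = 0) :
    PreservesSupport G := by
  classical
  refine ⟨hzero, fun x hx i hi => ?_⟩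
  have hvertex : 0 < G (Pi.single i 1) i := by
    obtain ⟨j, hj⟩ := (Pi.lt_def.1 (hpos _ (Pi.single_pos.2 one_pos))).2
    obtain rfl : j = i := by
      by_contra hji
      exact hj.ne' (hzero _ (Pi.single_pos.2 one_pos) j (Pi.single_eq_of_ne hji 1))
    exact hj
  set v : ι → ℝ := x i • Pi.single i 1 with hv
  have hv_pos : 0 < v := smul_pos hi (Pi.single_pos.2 one_pos)
  have hGv : G v = G (Pi.single i 1) := hG.map_smul hi (Pi.single_pos.2 one_pos)
  have hrest : 0 ≤ x - v := fun j => by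
    rcases eq_or_ne j i with rfl | hj
    · simp [hv]
    · simpa [hv, hj] using hx.le j
  rcases hrest.eq_or_lt with hrest | hrest
  · rwa [sub_eq_zero.1 hrest.symm, hGv]
  obtain ⟨a, b, ha, -, hab, hx_eq⟩ := mem_segment_iff_wbtw.2 (hG.wbtw_add hv_pos hrest)
  have hrest_i : (x - v) i = 0 := by simp [hv]
  rw [add_sub_cancel, hGv] at hx_eq
  rcases ha.eq_or_lt with rfl | ha
  · rw [zero_smul, zero_add, (zero_add b).symm.trans hab, one_smul] at hx_eq
    exact absurd (hsep x _ hx hrest hx_eq.symm i hrest_i) hi.ne'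
  · simpa [← hx_eq, hzero _ hrest i hrest_i] using mul_pos ha hvertex

variable [Fintype ι] {p : ι → E} {f : E → V}

/-- `f` acts on the points with homogeneous barycentric coordinates `x` with respect to `p` by
multiplying these coordinates by the positive weights `w`, where the coordinates of the image are
taken with respect to `f ∘ p`. For affinely independent `p` and `f ∘ p` these are the projective
transformations of the simplex in coordinates. -/
structure IsProjectiveWeight (f : E → V) (p : ι → E) (w : ι → ℝ) : Prop where
  pos : ∀ i, 0 < w i
  apply_centerMass : ∀ ⦃x : ι → ℝ⦄, 0 < x →
    f (Finset.univ.centerMass x p) = Finset.univ.centerMass (w * x) (f ∘ p)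

namespace IsMonotoneMap

theorem exists_centerMass_eq (hf : IsMonotoneMap ((convexHull ℝ (Set.range p)).domRestrict f))
    {x : ι → ℝ} (hx : 0 < x) :
    ∃ t : ι → ℝ, 0 < t ∧ (∀ i, x i = 0 → t i = 0) ∧
      Finset.univ.centerMass t (f ∘ p) = f (Finset.univ.centerMass x p) := by
  have hface : Finset.univ.centerMass x p ∈ convexHull ℝ (p '' {i | x i ≠ 0}) :=
    mem_convexHull_image_iff_exists_centerMass.2 ⟨x, hx, fun i hi => not_not.1 hi, rfl⟩
  have himage :=
    (hf.mono (convexHull_mono (Set.image_subset_range p _))).mapsTo_convexHull hface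
  rw [← Set.image_comp] at himage
  simpa using mem_convexHull_image_iff_exists_centerMass.1 himage

theorem exists_homogeneousMonotone_centerMass_eq
    (hf : IsMonotoneMap ((convexHull ℝ (Set.range p)).domRestrict f))
    (hq : AffineIndependent ℝ (f ∘ p)) :
    ∃ G : (ι → ℝ) → ι → ℝ, HomogeneousMonotone G ∧ ∀ x, 0 < x →
      0 < G x ∧ (∀ i, x i = 0 → G x i = 0) ∧
        Finset.univ.centerMass (G x) (f ∘ p) = f (Finset.univ.centerMass x p) := by
  classical
  obtain ⟨A, hA⟩ := exists_affineMap_apply_eq hq (V := ι → ℝ) fun i => Pi.single i 1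
  refine ⟨_, hf.homogeneousMonotone.affineMap_comp A, fun x hx => ?_⟩
  obtain ⟨t, ht, hzero, hfx⟩ := hf.exists_centerMass_eq hx
  have hsum : 0 < ∑ i, t i := Fintype.sum_pos ht
  have hAx : A (f (Finset.univ.centerMass x p)) = (∑ i, t i)⁻¹ • t := by
    rw [← hfx, affineMap_centerMass A _ hsum.ne', ← centerMass_pi_single]
    exact congrArg _ (funext hA)
  rw [Function.comp_apply, hAx]
  refine ⟨smul_pos (inv_pos.2 hsum) ht, fun i hi => by simp [hzero i hi], ?_⟩
  rw [Finset.centerMass_smul_left _ _ (inv_ne_zero hsum.ne'), hfx]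

theorem exists_isProjectiveWeight (hf : IsMonotoneMap ((convexHull ℝ (Set.range p)).domRestrict f))
    (hinj : Set.InjOn f (convexHull ℝ (Set.range p))) (hp : AffineIndependent ℝ p)
    (hq : AffineIndependent ℝ (f ∘ p)) (hι : 3 ≤ Fintype.card ι) :
    ∃ w, IsProjectiveWeight f p w := by
  classical
  obtain ⟨G, hG, hGf⟩ := hf.exists_homogeneousMonotone_centerMass_eq hq
  have hsupp : PreservesSupport G := by
    refine hG.preservesSupport (fun x hx => (hGf x hx).1) (fun x hx => (hGf x hx).2.1)
      fun x y hx hy hxy i hi => ?_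
    have hmem {z : ι → ℝ} (hz : 0 < z) :
        Finset.univ.centerMass z p ∈ convexHull ℝ (Set.range p) :=
      mem_convexHull_range_iff_exists_centerMass.2 ⟨z, hz, rfl⟩
    refine eq_zero_of_centerMass_eq hp hx hy (hinj (hmem hx) (hmem hy) ?_) hi
    rw [← (hGf x hx).2.2, ← (hGf y hy).2.2, hxy]
  have : Nonempty ι := Fintype.card_pos_iff.1 (by lia)
  have hw (i : ι) : 0 < G 1 i := hsupp.apply_pos one_pos one_pos
  refine ⟨G 1, hw, fun x hx => ?_⟩
  have hproportional : (∑ j, G 1 j * x j) • G x = (∑ j, G x j) • (G 1 * x) := by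
    ext k
    simp only [Pi.smul_apply, Pi.mul_apply, smul_eq_mul, Finset.sum_mul]
    refine Finset.sum_congr rfl fun j _ => ?_
    linear_combination hG.apply_mul_eq_mul_apply hsupp hι hx j k
  have hleft : 0 < ∑ j, G 1 j * x j := Fintype.sum_pos (mul_pos_of_forall_pos hw hx)
  have hright : 0 < ∑ j, G x j := Fintype.sum_pos (hGf x hx).1
  rw [← (hGf x hx).2.2, ← Finset.centerMass_smul_left _ _ hleft.ne', hproportional,
    Finset.centerMass_smul_left _ _ hright.ne']

end IsMonotoneMap

theorem IsProjectiveWeight.image_convexHull {w : ι → ℝ} (hw : IsProjectiveWeight f p w)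
    (s : Set ι) : f '' convexHull ℝ (p '' s) = convexHull ℝ ((f ∘ p) '' s) := by
  refine Set.Subset.antisymm (Set.image_subset_iff.2 fun y hy => ?_) fun y hy => ?_
  · obtain ⟨x, hx, hzero, rfl⟩ := mem_convexHull_image_iff_exists_centerMass.1 hy
    exact mem_convexHull_image_iff_exists_centerMass.2 ⟨w * x, mul_pos_of_forall_pos hw.pos hx,
      fun i hi => by simp [hzero i hi], (hw.apply_centerMass hx).symm⟩
  · obtain ⟨t, ht, hzero, rfl⟩ := mem_convexHull_image_iff_exists_centerMass.1 hy
    have htw : 0 < w⁻¹ * t := mul_pos_of_forall_pos (fun i => inv_pos.2 (hw.pos i)) ht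
    refine ⟨Finset.univ.centerMass (w⁻¹ * t) p, mem_convexHull_image_iff_exists_centerMass.2
      ⟨_, htw, fun i hi => by simp [hzero i hi], rfl⟩, ?_⟩
    rw [hw.apply_centerMass htw, show w * (w⁻¹ * t) = t from
      funext fun i => mul_inv_cancel_left₀ (hw.pos i).ne' _]

end Weights

section Nondegeneracy

variable {ι E V : Type*} [AddCommGroup E] [Module ℝ E] [AddCommGroup V] [Module ℝ V] {f : E → V}

theorem exists_dual_injOn_of_collinear {K W : Type*} [Field K] [AddCommGroup W] [Module K W]
    {s : Set W} (hs : Collinear K s) : ∃ φ : W →ₗ[K] K, Set.InjOn φ s := by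
  obtain ⟨o, v, hv⟩ := (collinear_iff_exists_forall_eq_smul_vadd s).1 hs
  rcases eq_or_ne v 0 with rfl | hv₀
  · simp only [smul_zero, zero_vadd] at hv
    exact ⟨0, fun x hx y hy _ => (hv x hx).choose_spec.trans (hv y hy).choose_spec.symm⟩
  obtain ⟨φ, hφ⟩ := Module.Projective.exists_dual_eq_one K hv₀
  refine ⟨φ, fun x hx y hy hxy => ?_⟩
  obtain ⟨r, rfl⟩ := hv x hx
  obtain ⟨t, rfl⟩ := hv y hy
  simp only [vadd_eq_add, map_add, map_smul, hφ, smul_eq_mul, mul_one, add_left_inj] at hxy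
  rw [hxy]

theorem collinear_convexHull {s : Set V} (hs : Collinear ℝ s) : Collinear ℝ (convexHull ℝ s) := by
  have hspan : Collinear ℝ (affineSpan ℝ s : Set V) := by
    rwa [Collinear, ← AffineSubspace.direction_eq_vectorSpan, direction_affineSpan]
  exact hspan.subset (convexHull_subset_affineSpan s)

namespace IsMonotoneMap

theorem affineIndependent_comp_fin_three {p : Fin 3 → E}
    (hf : IsMonotoneMap ((convexHull ℝ (Set.range p)).domRestrict f))
    (hinj : Set.InjOn f (convexHull ℝ (Set.range p))) (hp : AffineIndependent ℝ p) :
    AffineIndependent ℝ (f ∘ p) := by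
  rw [affineIndependent_iff_not_collinear]
  intro hcollinear
  obtain ⟨φ, hφ⟩ := exists_dual_injOn_of_collinear (collinear_convexHull hcollinear)
  obtain ⟨x, y, hx, hy, hxy, i, hyi, hxi⟩ :=
    (hf.homogeneousMonotone.affineMap_comp φ.toAffineMap).exists_apply_eq_of_face
  have hmem {z : Fin 3 → ℝ} (hz : 0 < z) :
      Finset.univ.centerMass z p ∈ convexHull ℝ (Set.range p) :=
    mem_convexHull_range_iff_exists_centerMass.2 ⟨z, hz, rfl⟩
  have hmaps := hf.mapsTo_convexHull
  rw [← Set.range_comp] at hmaps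
  exact hxi.ne' (eq_zero_of_centerMass_eq hp hx hy (hinj (hmem hx) (hmem hy)
    (hφ (hmaps (hmem hx)) (hmaps (hmem hy)) hxy)) hyi)

theorem convexHull_image_subset_of_notMem [Fintype ι] {p : ι → E} {i : ι} {J : Set ι}
    (hf : IsMonotoneMap ((convexHull ℝ (Set.range p)).domRestrict f))
    (hinj : Set.InjOn f (convexHull ℝ (Set.range p))) (hp : AffineIndependent ℝ p)
    (hq : AffineIndependent ℝ fun j : {j // j ≠ i} => f (p j)) (hι : 4 ≤ Fintype.card ι)
    (hi : i ∉ J) : convexHull ℝ ((f ∘ p) '' J) ⊆ f '' convexHull ℝ (p '' J) := by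
  classical
  set r : {j // j ≠ i} → E := fun j => p j
  have hr : convexHull ℝ (Set.range r) ⊆ convexHull ℝ (Set.range p) :=
    convexHull_mono (Set.range_comp_subset_range _ p)
  have hJ : Subtype.val '' ((↑) ⁻¹' J : Set {j // j ≠ i}) = J :=
    Set.image_preimage_eq_of_subset fun j hj => ⟨⟨j, fun h => hi (h ▸ hj)⟩, rfl⟩
  obtain ⟨w, hw⟩ := (hf.mono hr).exists_isProjectiveWeight (hinj.mono hr) (hp.subtype _) hq (by
    rw [Fintype.card_subtype_compl, Fintype.card_subtype_eq]
    lia)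
  have hface := (hw.image_convexHull ((↑) ⁻¹' J)).ge
  rwa [← hJ, ← Set.image_comp, ← Set.image_comp]

theorem affineIndependent_comp [Fintype ι] {p : ι → E}
    (hf : IsMonotoneMap ((convexHull ℝ (Set.range p)).domRestrict f))
    (hinj : Set.InjOn f (convexHull ℝ (Set.range p))) (hp : AffineIndependent ℝ p)
    (hι : 3 ≤ Fintype.card ι) : AffineIndependent ℝ (f ∘ p) := by
  classical
  obtain ⟨n, hn⟩ : ∃ n, Fintype.card ι = n := ⟨_, rfl⟩
  rw [hn] at hι
  induction n, hι using Nat.le_induction generalizing ι with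
  | base =>
    let e : Fin 3 ≃ ι := (Fintype.equivFinOfCardEq hn).symm
    have hrange : Set.range (p ∘ e) = Set.range p := e.surjective.range_comp p
    rw [← affineIndependent_equiv e]
    exact affineIndependent_comp_fin_three (p := p ∘ e) (hrange ▸ hf) (hrange ▸ hinj)
      ((affineIndependent_equiv e).2 hp)
  | succ n hι ih =>
    have hfacet (i : ι) : AffineIndependent ℝ fun j : {j // j ≠ i} => f (p j) := by
      have hsub : convexHull ℝ (Set.range fun j : {j // j ≠ i} => p j) ⊆
          convexHull ℝ (Set.range p) := convexHull_mono (Set.range_comp_subset_range _ p)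
      refine ih (hf.mono hsub) (hinj.mono hsub) (hp.subtype _) ?_
      rw [Fintype.card_subtype_compl, Fintype.card_subtype_eq, hn, Nat.add_sub_cancel]
    have hlift {J : Set ι} (hJ : Jᶜ.Nonempty) :
        convexHull ℝ ((f ∘ p) '' J) ⊆ f '' convexHull ℝ (p '' J) :=
      hJ.elim fun i hi =>
        hf.convexHull_image_subset_of_notMem hinj hp (hfacet i) (by lia) hi
    by_contra hq
    obtain ⟨I, z, hzI, hzIc⟩ := Convex.radon_partition hq
    obtain ⟨x, hx, hxz⟩ := hlift (Set.image_nonempty.1 (convexHull_nonempty_iff.1 ⟨z, hzIc⟩)) hzI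
    obtain ⟨y, hy, hyz⟩ := hlift (J := Iᶜ)
      (by simpa using Set.image_nonempty.1 (convexHull_nonempty_iff.1 ⟨z, hzI⟩)) hzIc
    have hface (J : Set ι) : convexHull ℝ (p '' J) ⊆ convexHull ℝ (Set.range p) :=
      convexHull_mono (Set.image_subset_range p J)
    have hxy : x = y := hinj (hface _ hx) (hface _ hy) (hxz.trans hyz.symm)
    exact (hp.affineSpan_disjoint_of_disjoint disjoint_compl_right).notMem_of_mem_left
      (convexHull_subset_affineSpan _ hx) (hxy ▸ convexHull_subset_affineSpan _ hy)

end IsMonotoneMap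

end Nondegeneracy

section ProjectiveMaps

variable {K U W : Type*} [DivisionRing K] [AddCommGroup U] [Module K U] [AddCommGroup W]
  [Module K W]

theorem submodule_projectivization_map {Φ : U →ₗ[K] W} (hΦ : Function.Injective Φ) (x : ℙ K U) :
    (Projectivization.map Φ hΦ x).submodule = x.submodule.map Φ := by
  induction x using Projectivization.ind with
  | h v hv =>
    rw [Projectivization.map_mk, Projectivization.submodule_mk, Projectivization.submodule_mk,
      Submodule.map_span, Set.image_singleton]

theorem projectivization_map_bijective (Φ : U ≃ₗ[K] W) :
    Function.Bijective (Projectivization.map Φ.toLinearMap Φ.injective) := by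
  refine ⟨Projectivization.map_injective Φ.toLinearMap Φ.injective, fun y => ?_⟩
  induction y using Projectivization.ind with
  | h v hv =>
    refine ⟨Projectivization.mk K (Φ.symm v) (by simpa using hv), ?_⟩
    rw [Projectivization.map_mk]
    simp

end ProjectiveMaps

section Homography

variable {ι E V : Type*} [AddCommGroup E] [Module ℝ E] [AddCommGroup V] [Module ℝ V]

theorem IsProjectiveLine.image_projectivization_map {U W : Type*} [AddCommGroup U] [Module ℝ U]
    [AddCommGroup W] [Module ℝ W] (Φ : U ≃ₗ[ℝ] W) {l : Set (ℙ ℝ U)} (hl : IsProjectiveLine l) :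
    IsProjectiveLine (Projectivization.map Φ.toLinearMap Φ.injective '' l) := by
  obtain ⟨M, hM, rfl⟩ := hl
  refine ⟨M.map Φ.toLinearMap, (LinearEquiv.finrank_map_eq Φ M).trans hM, ?_⟩
  have hmem (x : ℙ ℝ U) : (Projectivization.map Φ.toLinearMap Φ.injective x).submodule ≤
      M.map Φ.toLinearMap ↔ x.submodule ≤ M := by
    rw [submodule_projectivization_map]
    exact Submodule.map_le_map_iff_of_injective Φ.injective _ _
  rw [← (projectivization_map_bijective Φ).2.image_preimage {y | y.submodule ≤ _}]
  exact congrArg _ (Set.ext fun x => (hmem x).symm)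

theorem exists_isHomography_of_linearMap {A : AffineSubspace ℝ E} {B : AffineSubspace ℝ V}
    (L : E × ℝ →ₗ[ℝ] V × ℝ) (hmap : (homogenization A).map L = homogenization B)
    (hinj : Set.InjOn L (homogenization A)) :
    ∃ g : ProjectiveCompletion A → ProjectiveCompletion B, IsHomography g ∧
      ∀ (x : E) (hx : x ∈ A) (y : V) (hy : y ∈ B) (c : ℝ), L (x, 1) = c • (y, 1) →
        g (toProjective A x hx) = toProjective B y hy := by
  have hL : ∀ v ∈ homogenization A, L v ∈ homogenization B := fun v hv =>
    hmap ▸ Submodule.mem_map_of_mem hv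
  have hbij : Function.Bijective (L.restrict hL) := by
    refine ⟨fun u v huv => Subtype.ext (hinj u.2 v.2 (congrArg Subtype.val huv)), ?_⟩
    rintro ⟨y, hy⟩
    rw [← hmap] at hy
    obtain ⟨v, hv, rfl⟩ := hy
    exact ⟨⟨v, hv⟩, rfl⟩
  let Φ := LinearEquiv.ofBijective (L.restrict hL) hbij
  refine ⟨Projectivization.map Φ.toLinearMap Φ.injective,
    ⟨projectivization_map_bijective Φ, fun l hl => hl.image_projectivization_map Φ, ?_⟩, ?_⟩
  · let lift : E →ᵃ[ℝ] E × ℝ := (AffineMap.id ℝ E).prod (AffineMap.const ℝ E 1)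
    refine ⟨((LinearMap.fst ℝ V ℝ) ∘ₗ L).toAffineMap.comp lift,
      ((LinearMap.snd ℝ V ℝ) ∘ₗ L).toAffineMap.comp lift, fun x hx => ?_⟩
    rw [toProjective, Projectivization.map_mk, Projectivization.submodule_mk, Submodule.map_span,
      Set.image_singleton]
    rfl
  · intro x hx y hy c h
    rw [toProjective, toProjective, Projectivization.map_mk, Projectivization.mk_eq_mk_iff']
    exact ⟨c, Subtype.ext h.symm⟩

theorem homogenization_affineSpan (s : Set E) :
    homogenization (affineSpan ℝ s) = Submodule.span ℝ ((fun x => (x, (1 : ℝ))) '' s) := by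
  refine le_antisymm (Submodule.span_le.2 ?_)
    (Submodule.span_mono (Set.image_mono (subset_affineSpan ℝ s)))
  let lift : E →ᵃ[ℝ] E × ℝ := (AffineMap.id ℝ E).prod (AffineMap.const ℝ E 1)
  rintro _ ⟨x, hx, rfl⟩
  have hlift : lift x ∈ affineSpan ℝ (lift '' s) := by
    rw [← AffineSubspace.map_span]
    exact AffineSubspace.mem_map_of_mem lift hx
  exact affineSpan_subset_span hlift

theorem homogenization_affineSpan_range (p : ι → E) :
    homogenization (affineSpan ℝ (Set.range p)) =
      Submodule.span ℝ (Set.range fun i => (p i, (1 : ℝ))) := by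
  rw [homogenization_affineSpan, ← Set.range_comp, Function.comp_def]

theorem exists_linearMap_homogenization {p : ι → E} {q : ι → V} (hp : AffineIndependent ℝ p)
    (hq : AffineIndependent ℝ q) {w : ι → ℝ} (hw : ∀ i, w i ≠ 0) :
    ∃ L : E × ℝ →ₗ[ℝ] V × ℝ, (∀ i, L (p i, 1) = w i • (q i, 1)) ∧
      (homogenization (affineSpan ℝ (Set.range p))).map L =
        homogenization (affineSpan ℝ (Set.range q)) ∧
      Set.InjOn L (homogenization (affineSpan ℝ (Set.range p))) := by
  obtain ⟨L, hL⟩ := exists_linearMap_apply_eq (E := E × ℝ) (V := V × ℝ)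
    (linearIndependent_prod_one hp) fun i => w i • (q i, 1)
  have hLp : (L ∘ fun i => (p i, (1 : ℝ))) = fun i => w i • (q i, (1 : ℝ)) := funext hL
  have hspan : Submodule.span ℝ (Set.range fun i => w i • (q i, (1 : ℝ))) =
      Submodule.span ℝ (Set.range fun i => (q i, (1 : ℝ))) := by
    simp only [Submodule.span_range_eq_iSup, Submodule.span_singleton_smul_eq (hw _).isUnit]
  have hindep : LinearIndependent ℝ (L ∘ fun i => (p i, (1 : ℝ))) :=
    hLp ▸ (linearIndependent_prod_one hq).units_smul fun i => Units.mk0 (w i) (hw i)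
  refine ⟨L, hL, ?_, ?_⟩
  · rw [homogenization_affineSpan_range, homogenization_affineSpan_range, Submodule.map_span,
      ← Set.range_comp, hLp, hspan]
  · rw [homogenization_affineSpan_range]
    exact LinearMap.injOn_of_disjoint_ker subset_rfl (Submodule.range_ker_disjoint hindep)

theorem map_centerMass_prod_one [Fintype ι] {p : ι → E} {q : ι → V} {w x : ι → ℝ}
    {L : E × ℝ →ₗ[ℝ] V × ℝ} (hL : ∀ i, L (p i, 1) = w i • (q i, 1)) (hx : ∑ i, x i ≠ 0)
    (hwx : ∑ i, (w * x) i ≠ 0) :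
    L (Finset.univ.centerMass x p, 1) =
      ((∑ i, x i)⁻¹ * ∑ i, (w * x) i) • (Finset.univ.centerMass (w * x) q, 1) := by
  rw [mul_smul, ← sum_smul_prod_one q hwx, eq_inv_smul_iff₀ hx, ← map_smul,
    ← sum_smul_prod_one p hx, map_sum]
  simp only [map_smul, hL, smul_smul, Pi.mul_apply, mul_comm]

theorem IsProjectiveWeight.isPartialHomography [Fintype ι] {p : ι → E} {f : E → V} {w : ι → ℝ}
    (hw : IsProjectiveWeight f p w) (hp : AffineIndependent ℝ p)
    (hq : AffineIndependent ℝ (f ∘ p)) :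
    IsPartialHomography ((convexHull ℝ (Set.range p)).domRestrict f) := by
  have hA : affineSpan ℝ (convexHull ℝ (Set.range p)) = affineSpan ℝ (Set.range p) :=
    affineSpan_convexHull _
  have hB : affineSpan ℝ (Set.range ((convexHull ℝ (Set.range p)).domRestrict f)) =
      affineSpan ℝ (Set.range (f ∘ p)) := by
    rw [Set.range_domRestrict, ← Set.image_univ, hw.image_convexHull, Set.image_univ,
      affineSpan_convexHull]
  obtain ⟨L, hL, hmap, hinj⟩ := exists_linearMap_homogenization hp hq fun i => (hw.pos i).ne'
  rw [← hA, ← hB] at hmap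
  rw [← hA] at hinj
  obtain ⟨g, hg, hgf⟩ := exists_isHomography_of_linearMap L hmap hinj
  refine ⟨g, hg, ?_⟩
  rintro ⟨z, hz⟩
  obtain ⟨x, hx, rfl⟩ := mem_convexHull_range_iff_exists_centerMass.1 hz
  have hLx := map_centerMass_prod_one hL (Fintype.sum_pos hx).ne'
    (Fintype.sum_pos (mul_pos_of_forall_pos hw.pos hx)).ne'
  rw [← hw.apply_centerMass hx] at hLx
  exact hgf _ _ _ _ _ hLx

end Homography

theorem mainTheorem4 {E V : Type*} [AddCommGroup E] [Module ℝ E] [AddCommGroup V] [Module ℝ V]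
    (m : ℕ) (hm : 2 ≤ m) (Δ : Set E) (hΔ : IsSimplex m Δ)
    (f : Δ → V) (hinj : Function.Injective f) (hmono : IsMonotoneMap f) :
    IsSimplex m (Set.range f) ∧ IsPartialHomography f := by
  obtain ⟨p, hp, rfl⟩ := hΔ
  obtain ⟨F, rfl⟩ : ∃ F : E → V, (convexHull ℝ (Set.range p)).domRestrict F = f :=
    ⟨Function.extend Subtype.val f 0, Function.extend_comp Subtype.val_injective f 0⟩
  have hF : Set.InjOn F (convexHull ℝ (Set.range p)) := Set.injOn_iff_injective.2 hinj
  have hcard : 3 ≤ Fintype.card (Fin (m + 1)) := by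
    rw [Fintype.card_fin]
    lia
  have hq : AffineIndependent ℝ (F ∘ p) := hmono.affineIndependent_comp hF hp hcard
  obtain ⟨w, hw⟩ := hmono.exists_isProjectiveWeight hF hp hq hcard
  refine ⟨⟨F ∘ p, hq, ?_⟩, hw.isPartialHomography hp hq⟩
  rw [Set.range_domRestrict, ← Set.image_univ, hw.image_convexHull, Set.image_univ]
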